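/- **Setting.** Let $\mathrm R$ be a commutative monoid (written additively) with a total order such that $r\le s \iff r+t\le s+t$ for all $r,s,t\in\mathrm R$. *Language.* Types are $\sigma ::= b \mid \mathtt{Unit}\mid \sigma\times\sigma\mid\sigma\to\sigma$, where $b$ ranges over base types, including distinct base types $\mathtt{Bool}$ and $\mathtt{Rew}$. There are typed constants $c:b$, including $\mathtt{tt},\mathtt{ff}:\mathtt{Bool}$ and $0:\mathtt{Rew}$, and first-order function symbols $f:b_1\dots b_m\to b$, including $+:\mathtt{Rew}\,\mathtt{Rew}\to\mathtt{Rew}$, $\le\,:\mathtt{Rew}\,\mathtt{Rew}\to\mathtt{Bool}$ and equality $=_b\,:b\,b\to\mathtt{Bool}$ for each $b$; the rest of the vocabulary is arbitrary. Terms, up to $\alpha$-equivalence, with the usual simple typing, are $$M ::= x\mid c\mid f(M_1,\dots,M_m)\mid \mathtt{if}\ L\ \mathtt{then}\ M\ \mathtt{else}\ N\mid M\,\mathtt{or}\,N\mid N\cdot M\mid *\mid\langle M,N\rangle\mid\mathtt{fst}(M)\mid\mathtt{snd}(M)\mid\lambda x{:}\sigma.\,M\mid MN,$$ where $M\,\mathtt{or}\,N$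 requires $M,N$ of the same type $\sigma$ and has that type, and the reward operation $N\cdot M$ requires $N:\mathtt{Rew}$ and has the type of $M$. A *program* is a closed well-typed term. *Values* are $V::=c\mid *\mid\langle V,V'\rangle\mid\lambda x{:}\sigma.\,M$ (closed); $\mathrm{Val}_\sigma$ is the set of values of type $\sigma$. *Ordinary operational semantics.* For each $f$ and constants $c_1,\dots,c_m$ of its argument types a constant $\mathrm{val}_f(c_1,\dots,c_m)$ of its result type is given, with $\mathrm{val}_{=_b}(c_1,c_2)=\mathtt{tt}$ if $c_1=c_2$ and $\mathtt{ff}$ otherwise. Programs have the usual left-to-right call-by-value small-step transitions, in evaluation contexts $\mathcal E$: ordinary ones, with $f(c_1,\dots,c_m)\to\mathrm{val}_f(c_1,\dots,c_m)$ and the usual rules for conditionals, projections and $\beta_V$; and algebraic operation transitions, by which $\mathcal E[M_1\,\mathtt{or}\,M_2]$ moves under label $\mathtt{or}_i$ to $\mathcal E[M_i]$, and $\mathcal E[c\cdot M]$ under label $\mathtt{reward}_c$ to $\mathcal E[M]$. *Effect values* are $E::=V\mid E_1\,\mathtt{or}\,E_2\mid c\cdot E$ (with $c:\mathtt{Rew}$).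 The effect value $\mathrm{Op}(M)$ of a program $M$ is specified by: $\mathrm{Op}(M)=V$ if $M\to^*V$; $\mathrm{Op}(M)=\mathrm{Op}(M_1)\,\mathtt{or}\,\mathrm{Op}(M_2)$ if $M$ goes by ordinary transitions followed by an $\mathtt{or}_i$-transition to $M_i$ ($i=1,2$); and $\mathrm{Op}(M)=c\cdot\mathrm{Op}(M')$ if $M$ goes by ordinary transitions followed by a $\mathtt{reward}_c$-transition to $M'$. *Denotational semantics.* Base types denote sets $[\![b]\!]$ with $[\![\mathtt{Bool}]\!]=\{0,1\}$ and $[\![\mathtt{Rew}]\!]=\mathrm R$; constants denote elements $[\![c]\!]\in[\![b]\!]$, distinct constants of the same type having distinct denotations, with $[\![\mathtt{tt}]\!]=1$, $[\![\mathtt{ff}]\!]=0$ and $[\![0]\!]=0$; function symbols denote functions, with $[\![+]\!]$ and $[\![\le]\!]$ the addition and the order of $\mathrm R$, and $[\![f]\!]([\![c_1]\!],\dots,[\![c_m]\!])=[\![\mathrm{val}_f(c_1,\dots,c_m)]\!]$. Let $\mathrm W(X)=\mathrm R\times X$ be the writer monad and $\mathcal S(X)=(X\to\mathrm R)\to\mathrm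 W(X)$ the selection monad augmented with $\mathrm W$. For $u=\langle r,x\rangle\in\mathrm W(X)$ and $\gamma:X\to\mathrm R$ put $\mathbf R(u|\gamma)=r+\gamma(x)$. The unit of $\mathcal S$ is $x\mapsto\lambda\gamma.\langle 0,x\rangle$, and the Kleisli extension of $f:X\to\mathcal S(Y)$ maps $F$ to $$\lambda\gamma.\ \langle r+r',y\rangle,\qquad \langle r,x\rangle=F(\lambda x.\,\mathbf R(f(x)(\gamma)|\gamma)),\quad \langle r',y\rangle=f(x)(\gamma).$$ The standard call-by-value monadic semantics over $\mathcal S$ (with $[\![\mathtt{Unit}]\!]$ a one-point set, $[\![\sigma\times\tau]\!]=[\![\sigma]\!]\times[\![\tau]\!]$, $[\![\sigma\to\tau]\!]=[\![\sigma]\!]\to\mathcal S([\![\tau]\!])$) gives each program $M:\sigma$ a denotation $\mathcal S[\![M]\!]\in\mathcal S([\![\sigma]\!])$, where $\mathtt{or}$ denotes $(G_0,G_1)\mapsto\lambda\gamma.\,(G_0\gamma$ if $\mathbf R(G_0\gamma|\gamma)\ge\mathbf R(G_1\gamma|\gamma)$, and $G_1\gamma$ otherwise$)$, and the reward operation denotes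 the Kleisli lifting in its first argument of $(r,G)\mapsto\lambda\gamma.\,\langle r+\pi_1(G\gamma),\pi_2(G\gamma)\rangle$. Values $V:\sigma$ have an effect-free denotation $\mathcal S_p[\![V]\!]\in[\![\sigma]\!]$: $\mathcal S_p[\![c]\!]=[\![c]\!]$, $\mathcal S_p[\![*]\!]$ is the point, $\mathcal S_p[\![\langle V,V'\rangle]\!]=\langle\mathcal S_p[\![V]\!],\mathcal S_p[\![V']\!]\rangle$, and $\mathcal S_p[\![\lambda x.\,N]\!]$ is the function denoted by $x\vdash N$. *Selection operational semantics.* The finite totally ordered set $\mathrm{Str}(E)$ of strategies of an effect value $E$ is: $\{*\}$ if $E$ is a value; the set of all $1s$ with $s\in\mathrm{Str}(E_1)$ and all $2s$ with $s\in\mathrm{Str}(E_2)$ if $E=E_1\,\mathtt{or}\,E_2$, the former before the latter and each kind ordered as its $s$; and $\mathrm{Str}(E')$, with its order, if $E=c\cdot E'$. Outcomes $\mathrm{Out}(s,E)\in\mathrm R\times\mathrm{Val}_\sigma$ are given by $\mathrm{Out}(*,V)=\langle 0,V\rangle$, $\mathrm{Out}(is,E_1\,\mathtt{or}\,E_2)=\mathrm{Out}(s,E_i)$,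 and $\mathrm{Out}(s,c\cdot E)=\langle[\![c]\!]+r,V\rangle$ if $\mathrm{Out}(s,E)=\langle r,V\rangle$. Let $s_{\mathrm{opt}}(E)$ be the least strategy of $E$ among those maximizing the reward $\pi_1(\mathrm{Out}(s,E))$, and put $\mathrm{Op}_s(M)=\mathrm{Out}(s_{\mathrm{opt}}(\mathrm{Op}(M)),\mathrm{Op}(M))$. **Theorem (Selection adequacy).** Let $M:\sigma$ be a program. Then $\mathrm{Op}(M)$ is well defined, that is, there is exactly one effect value with the above specification, and, with $0$ the constantly zero reward continuation, $$\mathcal S[\![M]\!](0)=\mathrm W(\mathcal S_p)(\mathrm{Op}_s(M)),$$ i.e. if $\mathrm{Op}_s(M)=\langle r,V\rangle$ then $\mathcal S[\![M]\!](0)=\langle r,\mathcal S_p[\![V]\!]\rangle$. -/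

import Mathlib

universe u v

namespace ChoiceReward

/-! ## Syntax -/

/-- Base types: `Bool`, `Rew`, and any further ones. -/
inductive BaseTy (B : Type v) : Type v
  | bool : BaseTy B
  | rew : BaseTy B
  | other (b : B) : BaseTy B

/-- A basic vocabulary: further base types, constants, first-order function symbols (indexed by
their arity and co-arity), and the operational evaluation `val` of function symbols on constants.
`tt`, `ff`, `0`, `+`, `≤` and the equality symbols are always present; everything else is
unspecified. -/
structure Vocab where
  B : Type v
  Con : BaseTy B → Type v
  Fn : (n : ℕ) → (Fin n → BaseTy B) → BaseTy B → Type v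
  tt : Con .bool
  ff : Con .bool
  zero : Con .rew
  plus : Fn 2 (fun _ => .rew) .rew
  leq : Fn 2 (fun _ => .rew) .bool
  eq : (b : BaseTy B) → Fn 2 (fun _ => b) .bool
  val : {n : ℕ} → {bs : Fin n → BaseTy B} → {b : BaseTy B} →
    Fn n bs b → ((i : Fin n) → Con (bs i)) → Con b
  val_eq_of_eq : ∀ (b : BaseTy B) (c : Fin 2 → Con b), c 0 = c 1 → val (eq b) c = tt
  val_eq_of_ne : ∀ (b : BaseTy B) (c : Fin 2 → Con b), c 0 ≠ c 1 → val (eq b) c = ff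

/-- Types. -/
inductive Ty (B : Type v) : Type v
  | base (b : BaseTy B) : Ty B
  | unit : Ty B
  | prod (σ τ : Ty B) : Ty B
  | arr (σ τ : Ty B) : Ty B

/-- `Var Γ σ`: the variables (de Bruijn indices) of type `σ` in the environment `Γ`. -/
inductive Var {B : Type v} : List (Ty B) → Ty B → Type v
  | here {Γ : List (Ty B)} {σ : Ty B} : Var (σ :: Γ) σ
  | there {Γ : List (Ty B)} {σ τ : Ty B} (x : Var Γ σ) : Var (τ :: Γ) σ

/-- `Tm S Γ σ`: the terms `M` with `Γ ⊢ M : σ`, up to α-equivalence. The algebraic operation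
symbols are exactly `or : ε; 2` and `reward : Rew; 1`. -/
inductive Tm (S : Vocab.{v}) : List (Ty S.B) → Ty S.B → Type v
  | var {Γ : List (Ty S.B)} {σ : Ty S.B} (x : Var Γ σ) : Tm S Γ σ
  | con {Γ : List (Ty S.B)} {b : BaseTy S.B} (c : S.Con b) : Tm S Γ (.base b)
  | fn {Γ : List (Ty S.B)} {n : ℕ} {bs : Fin n → BaseTy S.B} {b : BaseTy S.B} (f : S.Fn n bs b)
      (Ms : (i : Fin n) → Tm S Γ (.base (bs i))) : Tm S Γ (.base b)
  | ite {Γ : List (Ty S.B)} {σ : Ty S.B} (L : Tm S Γ (.base .bool)) (M N : Tm S Γ σ) : Tm S Γ σ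
  | or {Γ : List (Ty S.B)} {σ : Ty S.B} (M N : Tm S Γ σ) : Tm S Γ σ
  | reward {Γ : List (Ty S.B)} {σ : Ty S.B} (N : Tm S Γ (.base .rew)) (M : Tm S Γ σ) : Tm S Γ σ
  | star {Γ : List (Ty S.B)} : Tm S Γ .unit
  | pair {Γ : List (Ty S.B)} {σ τ : Ty S.B} (M : Tm S Γ σ) (N : Tm S Γ τ) : Tm S Γ (.prod σ τ)
  | fst {Γ : List (Ty S.B)} {σ τ : Ty S.B} (M : Tm S Γ (.prod σ τ)) : Tm S Γ σ
  | snd {Γ : List (Ty S.B)} {σ τ : Ty S.B} (M : Tm S Γ (.prod σ τ)) : Tm S Γ τ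
  | lam {Γ : List (Ty S.B)} {σ τ : Ty S.B} (M : Tm S (σ :: Γ) τ) : Tm S Γ (.arr σ τ)
  | app {Γ : List (Ty S.B)} {σ τ : Ty S.B} (M : Tm S Γ (.arr σ τ)) (N : Tm S Γ σ) : Tm S Γ τ

/-- Programs: closed well-typed terms. -/
abbrev Program (S : Vocab.{v}) (σ : Ty S.B) : Type v := Tm S [] σ

/-! ## Substitution -/

/-- Extension of a renaming under a binder. -/
def Var.lift {B : Type v} {Γ Δ : List (Ty B)} (r : ∀ τ, Var Γ τ → Var Δ τ) (ρ : Ty B) :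
    ∀ τ, Var (ρ :: Γ) τ → Var (ρ :: Δ) τ
  | _, .here => .here
  | _, .there x => .there (r _ x)

def Tm.rename {S : Vocab.{v}} {Γ : List (Ty S.B)} {σ : Ty S.B} (M : Tm S Γ σ) :
    ∀ {Δ : List (Ty S.B)}, (∀ τ, Var Γ τ → Var Δ τ) → Tm S Δ σ :=
  match M with
  | .var x => fun r => .var (r _ x)
  | .con c => fun _ => .con c
  | .fn f Ms => fun r => .fn f (fun i => (Ms i).rename r)
  | .ite L M N => fun r => .ite (L.rename r) (M.rename r) (N.rename r)
  | .or M N => fun r => .or (M.rename r) (N.rename r)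
  | .reward N M => fun r => .reward (N.rename r) (M.rename r)
  | .star => fun _ => .star
  | .pair M N => fun r => .pair (M.rename r) (N.rename r)
  | .fst M => fun r => .fst (M.rename r)
  | .snd M => fun r => .snd (M.rename r)
  | .lam M => fun r => .lam (M.rename (Var.lift r _))
  | .app M N => fun r => .app (M.rename r) (N.rename r)

/-- Extension of a simultaneous substitution under a binder. -/
def Tm.liftSubst {S : Vocab.{v}} {Γ Δ : List (Ty S.B)} (s : ∀ τ, Var Γ τ → Tm S Δ τ)
    (ρ : Ty S.B) : ∀ τ, Var (ρ :: Γ) τ → Tm S (ρ :: Δ) τ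
  | _, .here => .var .here
  | _, .there x => (s _ x).rename (fun _ y => .there y)

/-- Simultaneous capture-avoiding substitution. -/
def Tm.subst {S : Vocab.{v}} {Γ : List (Ty S.B)} {σ : Ty S.B} (M : Tm S Γ σ) :
    ∀ {Δ : List (Ty S.B)}, (∀ τ, Var Γ τ → Tm S Δ τ) → Tm S Δ σ :=
  match M with
  | .var x => fun s => s _ x
  | .con c => fun _ => .con c
  | .fn f Ms => fun s => .fn f (fun i => (Ms i).subst s)
  | .ite L M N => fun s => .ite (L.subst s) (M.subst s) (N.subst s)
  | .or M N => fun s => .or (M.subst s) (N.subst s)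
  | .reward N M => fun s => .reward (N.subst s) (M.subst s)
  | .star => fun _ => .star
  | .pair M N => fun s => .pair (M.subst s) (N.subst s)
  | .fst M => fun s => .fst (M.subst s)
  | .snd M => fun s => .snd (M.subst s)
  | .lam M => fun s => .lam (M.subst (Tm.liftSubst s _))
  | .app M N => fun s => .app (M.subst s) (N.subst s)

/-- The substitution of `N` for the only free variable. -/
def Tm.single {S : Vocab.{v}} {σ : Ty S.B} (N : Program S σ) : ∀ τ, Var [σ] τ → Program S τ
  | _, .here => N

/-- `M[N/x]`, for `x : σ ⊢ M : τ` and a closed `N : σ`. -/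
def Tm.inst {S : Vocab.{v}} {σ τ : Ty S.B} (M : Tm S [σ] τ) (N : Program S σ) : Program S τ :=
  M.subst (Tm.single N)

/-! ## Ordinary operational semantics -/

/-- `Val S σ`: the values of type `σ`. -/
inductive Val (S : Vocab.{v}) : Ty S.B → Type v
  | con {b : BaseTy S.B} (c : S.Con b) : Val S (.base b)
  | star : Val S .unit
  | pair {σ τ : Ty S.B} (V : Val S σ) (W : Val S τ) : Val S (.prod σ τ)
  | lam {σ τ : Ty S.B} (M : Tm S [σ] τ) : Val S (.arr σ τ)

/-- Values are programs. -/
def Val.toTm {S : Vocab.{v}} : ∀ {σ : Ty S.B}, Val S σ → Program S σ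
  | _, .con c => .con c
  | _, .star => .star
  | _, .pair V W => .pair V.toTm W.toTm
  | _, .lam M => .lam M

/-- `ECtx S ρ σ`: closed evaluation contexts of type `σ` whose hole has type `ρ`. -/
inductive ECtx (S : Vocab.{v}) (ρ : Ty S.B) : Ty S.B → Type v
  | hole : ECtx S ρ ρ
  | fn {n : ℕ} {bs : Fin n → BaseTy S.B} {b : BaseTy S.B} (f : S.Fn n bs b) (k : Fin n)
      (cs : (i : Fin n) → i < k → S.Con (bs i)) (E : ECtx S ρ (.base (bs k)))
      (Ms : (i : Fin n) → k < i → Program S (.base (bs i))) : ECtx S ρ (.base b)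
  | ite {σ : Ty S.B} (E : ECtx S ρ (.base .bool)) (M N : Program S σ) : ECtx S ρ σ
  | reward {σ : Ty S.B} (E : ECtx S ρ (.base .rew)) (M : Program S σ) : ECtx S ρ σ
  | pairL {σ τ : Ty S.B} (E : ECtx S ρ σ) (N : Program S τ) : ECtx S ρ (.prod σ τ)
  | pairR {σ τ : Ty S.B} (V : Val S σ) (E : ECtx S ρ τ) : ECtx S ρ (.prod σ τ)
  | fst {σ τ : Ty S.B} (E : ECtx S ρ (.prod σ τ)) : ECtx S ρ σ
  | snd {σ τ : Ty S.B} (E : ECtx S ρ (.prod σ τ)) : ECtx S ρ τ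
  | appL {σ τ : Ty S.B} (E : ECtx S ρ (.arr σ τ)) (N : Program S σ) : ECtx S ρ τ
  | appR {σ τ : Ty S.B} (M : Tm S [σ] τ) (E : ECtx S ρ σ) : ECtx S ρ τ

/-- `E.plug M` is `E[M]`. -/
def ECtx.plug {S : Vocab.{v}} {ρ : Ty S.B} : ∀ {σ : Ty S.B}, ECtx S ρ σ → Program S ρ → Program S σ
  | _, .hole, M => M
  | _, .fn f k cs E Ms, M => .fn f (fun i =>
      if h₁ : i < k then .con (cs i h₁)
      else if h₂ : k < i then Ms i h₂
      else (le_antisymm (not_lt.mp h₁) (not_lt.mp h₂)) ▸ E.plug M)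
  | _, .ite E N₁ N₂, M => .ite (E.plug M) N₁ N₂
  | _, .reward E N, M => .reward (E.plug M) N
  | _, .pairL E N, M => .pair (E.plug M) N
  | _, .pairR V E, M => .pair V.toTm (E.plug M)
  | _, .fst E, M => .fst (E.plug M)
  | _, .snd E, M => .snd (E.plug M)
  | _, .appL E N, M => .app (E.plug M) N
  | _, .appR L E, M => .app (.lam L) (E.plug M)

/-- Ordinary transitions of redexes. -/
inductive Red {S : Vocab.{v}} : ∀ {σ : Ty S.B}, Program S σ → Program S σ → Prop
  | fn {n : ℕ} {bs : Fin n → BaseTy S.B} {b : BaseTy S.B} (f : S.Fn n bs b)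
      (cs : (i : Fin n) → S.Con (bs i)) : Red (.fn f (fun i => .con (cs i))) (.con (S.val f cs))
  | ite_tt {σ : Ty S.B} (M N : Program S σ) : Red (.ite (.con S.tt) M N) M
  | ite_ff {σ : Ty S.B} (M N : Program S σ) : Red (.ite (.con S.ff) M N) N
  | fst {σ τ : Ty S.B} (V : Val S σ) (W : Val S τ) : Red (.fst (.pair V.toTm W.toTm)) V.toTm
  | snd {σ τ : Ty S.B} (V : Val S σ) (W : Val S τ) : Red (.snd (.pair V.toTm W.toTm)) W.toTm
  | beta {σ τ : Ty S.B} (M : Tm S [σ] τ) (V : Val S σ) : Red (.app (.lam M) V.toTm) (M.inst V.toTm)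

/-- Labels of the algebraic operation transitions: which operation is executed, with which
parameters, and which of its arguments is followed. -/
inductive OpLabel (S : Vocab.{v}) : Type v
  | or₁ : OpLabel S
  | or₂ : OpLabel S
  | reward (c : S.Con .rew) : OpLabel S

/-- Algebraic operation transitions of redexes. -/
inductive RedOp {S : Vocab.{v}} {σ : Ty S.B} : OpLabel S → Program S σ → Program S σ → Prop
  | or₁ (M₁ M₂ : Program S σ) : RedOp .or₁ (.or M₁ M₂) M₁
  | or₂ (M₁ M₂ : Program S σ) : RedOp .or₂ (.or M₁ M₂) M₂
  | reward (c : S.Con .rew) (M : Program S σ) : RedOp (.reward c) (.reward (.con c) M) M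

/-- Ordinary small-step transitions of programs. -/
inductive Step {S : Vocab.{v}} {σ : Ty S.B} : Program S σ → Program S σ → Prop
  | ctx {ρ : Ty S.B} (E : ECtx S ρ σ) {R M : Program S ρ} (h : Red R M) :
      Step (E.plug R) (E.plug M)

/-- Small-step algebraic operation transitions of programs. -/
inductive StepOp {S : Vocab.{v}} {σ : Ty S.B} : OpLabel S → Program S σ → Program S σ → Prop
  | ctx {ρ : Ty S.B} (E : ECtx S ρ σ) {l : OpLabel S} {R M : Program S ρ} (h : RedOp l R M) :
      StepOp l (E.plug R) (E.plug M)

/-- Big-step transition to a value, `M ⇒ V`. -/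
def BigVal {S : Vocab.{v}} {σ : Ty S.B} (M : Program S σ) (V : Val S σ) : Prop :=
  Relation.ReflTransGen Step M V.toTm

/-- Big-step algebraic operation transitions. -/
def BigOp {S : Vocab.{v}} {σ : Ty S.B} (l : OpLabel S) (M N : Program S σ) : Prop :=
  ∃ M' : Program S σ, Relation.ReflTransGen Step M M' ∧ StepOp l M' N

/-- Effect values. -/
inductive EffVal (S : Vocab.{v}) (σ : Ty S.B) : Type v
  | val (V : Val S σ) : EffVal S σ
  | or (E₁ E₂ : EffVal S σ) : EffVal S σ
  | reward (c : S.Con .rew) (E : EffVal S σ) : EffVal S σ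

/-- `Evaluates M E`: the program `M` evaluates to the effect value `E`, i.e. `Op(M) = E`. -/
inductive Evaluates {S : Vocab.{v}} {σ : Ty S.B} : Program S σ → EffVal S σ → Prop
  | val {M : Program S σ} {V : Val S σ} (h : BigVal M V) : Evaluates M (.val V)
  | or {M M₁ M₂ : Program S σ} {E₁ E₂ : EffVal S σ} (h₁ : BigOp .or₁ M M₁) (h₂ : BigOp .or₂ M M₂)
      (e₁ : Evaluates M₁ E₁) (e₂ : Evaluates M₂ E₂) : Evaluates M (.or E₁ E₂)
  | reward {M M' : Program S σ} {c : S.Con .rew} {E : EffVal S σ} (h : BigOp (.reward c) M M')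
      (e : Evaluates M' E) : Evaluates M (.reward c E)

/-! ## Writer monad and the selection monad augmented with it -/

/-- The writer monad. -/
abbrev W (R X : Type*) := R × X

namespace W

variable {R : Type*} {X Y : Type*}

def map (f : X → Y) (u : W R X) : W R Y := (u.1, f u.2)

variable [AddCommMonoid R]

def pure (x : X) : W R X := (0, x)

/-- Kleisli extension. -/
def bind (u : W R X) (f : X → W R Y) : W R Y := (u.1 + (f u.2).1, (f u.2).2)

/-- The reward operation of the writer monad. -/
def reward (r : R) (u : W R X) : W R X := (r + u.1, u.2)

/-- The algebra structure on `R`. -/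
def alpha (u : W R R) : R := u.1 + u.2

/-- The reward of `u` with respect to the reward continuation `γ`. -/
def rew (u : W R X) (γ : X → R) : R := alpha (map γ u)

end W

/-- The selection monad augmented with the writer monad. -/
abbrev Sel (R X : Type*) := (X → R) → W R X

/-- `x max_γ y`: the left argument, unless the right one has strictly larger reward. -/
def maxBy {R X : Type*} [LinearOrder R] (γ : X → R) (x y : X) : X :=
  if γ x ≥ γ y then x else y

namespace Sel

variable {R : Type*} {X Y : Type*} [AddCommMonoid R]

def pure (x : X) : Sel R X := fun _ => W.pure x

/-- Kleisli extension. -/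
def bind (F : Sel R X) (f : X → Sel R Y) : Sel R Y := fun γ =>
  W.bind (F (fun x => W.rew (f x γ) γ)) (fun x => f x γ)

/-- Evaluation of a finite tuple of computations, from left to right. -/
def seq : ∀ {n : ℕ} {D : Fin n → Type*}, ((i : Fin n) → Sel R (D i)) → Sel R ((i : Fin n) → D i)
  | 0, _, _ => pure (fun i => i.elim0)
  | _ + 1, _, F => bind (F 0) (fun a => bind (seq (fun i => F i.succ)) (fun as =>
      pure (Fin.cons a as)))

/-- The algebraic operation interpreting `or`. -/
def or [LinearOrder R] (G₀ G₁ : Sel R X) : Sel R X := fun γ =>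
  maxBy (fun u => W.rew u γ) (G₀ γ) (G₁ γ)

/-- The algebraic operation interpreting `reward`. -/
def reward (r : R) (G : Sel R X) : Sel R X := fun γ => W.reward r (G γ)

end Sel

/-! ## Denotational semantics -/

/-- The sets denoted by base types, given the rewards `R` and the denotations `D` of the further
base types. -/
def BaseTy.den {B : Type v} (R : Type u) (D : B → Type u) : BaseTy B → Type u
  | .bool => ULift.{u} Bool
  | .rew => R
  | .other b => D b

/-- The semantics of a basic vocabulary: distinct constants of the same type have distinct
denotations, and the denotations of function symbols agree with their operational evaluation. -/
structure Interp (S : Vocab.{v}) (R : Type u) [AddCommMonoid R] [LinearOrder R] where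
  D : S.B → Type u
  con : {b : BaseTy S.B} → S.Con b → b.den R D
  fn : {n : ℕ} → {bs : Fin n → BaseTy S.B} → {b : BaseTy S.B} → S.Fn n bs b →
    ((i : Fin n) → (bs i).den R D) → b.den R D
  con_injective : ∀ b : BaseTy S.B, Function.Injective (con : S.Con b → b.den R D)
  con_tt : con S.tt = ULift.up true
  con_ff : con S.ff = ULift.up false
  con_zero : con S.zero = (0 : R)
  fn_plus : ∀ r : Fin 2 → R, fn S.plus r = (r 0 + r 1 : R)
  fn_leq : ∀ r : Fin 2 → R, fn S.leq r = ULift.up (decide (r 0 ≤ r 1))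
  fn_val : ∀ {n : ℕ} {bs : Fin n → BaseTy S.B} {b : BaseTy S.B} (f : S.Fn n bs b)
    (cs : (i : Fin n) → S.Con (bs i)), fn f (fun i => con (cs i)) = con (S.val f cs)

section Denotation

variable {S : Vocab.{v}} {R : Type u} [AddCommMonoid R] [LinearOrder R]

/-- The reward denoted by a constant of type `Rew`. -/
def Interp.conRew (I : Interp S R) (c : S.Con .rew) : R := I.con c

/-- Denotations of types. -/
def Interp.ty (I : Interp S R) : Ty S.B → Type u
  | .base b => b.den R I.D
  | .unit => PUnit
  | .prod σ τ => I.ty σ × I.ty τ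
  | .arr σ τ => I.ty σ → Sel R (I.ty τ)

/-- The denotation of an environment: a tuple of elements of the denotations of its types. -/
def Interp.Env (I : Interp S R) (Γ : List (Ty S.B)) := ∀ τ, Var Γ τ → I.ty τ

def Interp.nil (I : Interp S R) : I.Env [] := fun _ x => nomatch x

def Interp.cons (I : Interp S R) {Γ : List (Ty S.B)} {σ : Ty S.B} (a : I.ty σ) (ρ : I.Env Γ) :
    I.Env (σ :: Γ)
  | _, .here => a
  | _, .there x => ρ _ x

/-- Denotations of terms. -/
def Interp.tm (I : Interp S R) : ∀ {Γ : List (Ty S.B)} {σ : Ty S.B},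
    Tm S Γ σ → I.Env Γ → Sel R (I.ty σ)
  | _, _, .var x, ρ => Sel.pure (ρ _ x)
  | _, _, .con c, _ => Sel.pure (X := I.ty (.base _)) (I.con c)
  | _, _, .fn (bs := bs) f Ms, ρ =>
      Sel.bind (Sel.seq (D := fun i => I.ty (.base (bs i))) (fun i => I.tm (Ms i) ρ))
        (fun a => Sel.pure (X := I.ty (.base _)) (I.fn f a))
  | _, _, .ite L M N, ρ => Sel.bind (I.tm L ρ) (fun b : ULift.{u} Bool =>
      if b.down then I.tm M ρ else I.tm N ρ)
  | _, _, .or M N, ρ => Sel.or (I.tm M ρ) (I.tm N ρ)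
  | _, _, .reward N M, ρ => Sel.bind (I.tm N ρ) (fun r : R => Sel.reward r (I.tm M ρ))
  | _, _, .star, _ => Sel.pure (X := I.ty .unit) PUnit.unit
  | _, _, .pair (σ := σ) (τ := τ) M N, ρ => Sel.bind (I.tm M ρ) (fun a =>
      Sel.bind (I.tm N ρ) (fun b => Sel.pure (X := I.ty (.prod σ τ)) (a, b)))
  | _, _, .fst (σ := σ) (τ := τ) M, ρ =>
      Sel.bind (I.tm M ρ) (fun p : I.ty σ × I.ty τ => Sel.pure p.1)
  | _, _, .snd (σ := σ) (τ := τ) M, ρ =>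
      Sel.bind (I.tm M ρ) (fun p : I.ty σ × I.ty τ => Sel.pure p.2)
  | _, _, .lam (σ := σ) (τ := τ) M, ρ =>
      Sel.pure (X := I.ty (.arr σ τ)) (fun a => I.tm M (I.cons a ρ))
  | _, _, .app (σ := σ) (τ := τ) M N, ρ =>
      Sel.bind (I.tm M ρ) (fun f : I.ty σ → Sel R (I.ty τ) => Sel.bind (I.tm N ρ) f)

/-- The denotation of a program. -/
def Interp.program (I : Interp S R) {σ : Ty S.B} (M : Program S σ) : Sel R (I.ty σ) :=
  I.tm M I.nil

/-- The effect-free semantics of values. -/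
def Interp.val (I : Interp S R) : ∀ {σ : Ty S.B}, Val S σ → I.ty σ
  | _, .con c => I.con c
  | _, .star => PUnit.unit
  | _, .pair V W => (I.val V, I.val W)
  | _, .lam M => fun a => I.tm M (I.cons a I.nil)

end Denotation

/-! ## Selection operational semantics -/

section Selection

variable {S : Vocab.{v}} {σ : Ty S.B}

/-- The strategies of an effect value, viewed as a one-player game: the strategies `1s` and `2s` of
`E₁ or E₂` are the elements of the left and of the right summand, and these are ordered
lexicographically, those of the left summand first. -/
def Str : EffVal S σ → Type
  | .val _ => Unit
  | .or E₁ E₂ => Lex (Str E₁ ⊕ Str E₂)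
  | .reward _ E => Str E

/-- The total order on the strategies of a game. -/
@[reducible] noncomputable def Str.linearOrder : (E : EffVal S σ) → LinearOrder (Str E)
  | .val _ => inferInstanceAs (LinearOrder Unit)
  | .or E₁ E₂ => @Sum.Lex.linearOrder (Str E₁) (Str E₂) (Str.linearOrder E₁) (Str.linearOrder E₂)
  | .reward _ E => Str.linearOrder E

@[reducible] def Str.fintype : (E : EffVal S σ) → Fintype (Str E)
  | .val _ => inferInstanceAs (Fintype Unit)
  | .or E₁ E₂ => @instFintypeSum (Str E₁) (Str E₂) (Str.fintype E₁) (Str.fintype E₂)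
  | .reward _ E => Str.fintype E

theorem Str.nonempty : (E : EffVal S σ) → Nonempty (Str E)
  | .val _ => inferInstanceAs (Nonempty Unit)
  | .or E₁ _ => (Str.nonempty E₁).map (fun s => toLex (Sum.inl s))
  | .reward _ E => Str.nonempty E

noncomputable instance Str.instLinearOrder (E : EffVal S σ) : LinearOrder (Str E) := Str.linearOrder E
instance Str.instFintype (E : EffVal S σ) : Fintype (Str E) := Str.fintype E
instance Str.instNonempty (E : EffVal S σ) : Nonempty (Str E) := Str.nonempty E

variable {R : Type u} [LinearOrder R]

theorem exists_maximizer {T : Type*} [Fintype T] [Nonempty T] (γ : T → R) :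
    (Finset.univ.filter (fun s => ∀ t, γ t ≤ γ s)).Nonempty := by
  obtain ⟨s, hs⟩ := Finite.exists_max γ
  exact ⟨s, by simpa using hs⟩

/-- The least element among those maximizing `γ`. -/
def argmax {T : Type*} [LinearOrder T] [Fintype T] [Nonempty T] (γ : T → R) : T :=
  (Finset.univ.filter (fun s => ∀ t, γ t ≤ γ s)).min' (exists_maximizer γ)

variable [AddCommMonoid R]

/-- The outcome of a strategy. -/
def Interp.out (I : Interp S R) : (E : EffVal S σ) → Str E → W R (Val S σ)
  | .val V, _ => W.pure V
  | .or E₁ E₂, s => Sum.elim (I.out E₁) (I.out E₂) (ofLex s)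
  | .reward c E, s => W.reward (I.conRew c) (I.out E s)

/-- The reward of a strategy. -/
def Interp.strRew (I : Interp S R) (E : EffVal S σ) (s : Str E) : R := (I.out E s).1

/-- The outcome of the optimal strategy of an effect value. For `E = Op(M)` this is the selection
operational semantics of the program `M`. -/
noncomputable def Interp.opS (I : Interp S R) (E : EffVal S σ) : W R (Val S σ) :=
  I.out E (argmax (I.strRew E))

end Selection

end ChoiceReward

namespace ChoiceReward

/-! ## Monad laws -/

/-! The denotation and the optimal outcome satisfy the same recursion along the computation tree of
the program. In the denotation of a program in an evaluation context, the context contributes only a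
Kleisli continuation applied to the denotation of the hole (`Interp.program_plug`). Ordinary
transitions therefore preserve denotations. Moreover `or` and `reward` commute with Kleisli
extension (`Sel.or_bind`, `Sel.reward_bind`), so an operation transition exhibits the denotation as
that operation applied to the denotations of the successors. At the zero continuation the reward of
a writer pair is its first component, so `or` keeps the better branch, the left one on ties, and
`reward` adds a constant. The least optimal strategy behaves alike (`Interp.opS_or`,
`Interp.opS_reward`): left strategies precede right ones, and translation by a constant preserves
and reflects the order.

Existence of the effect value is a computability argument for branching computations
(`Terminates.subst`). Uniqueness is determinism: every transition agrees with the function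
`Tm.next`. Both use `SmallEvaluates`, which consumes one transition at a time. The semantics enters
here only through `Bool`: its interpretation forces `tt` and `ff` to be distinct and to be the only
constants of that type. -/

theorem W.bind_assoc {R X Y Z : Type*} [AddCommMonoid R] (u : W R X) (f : X → W R Y)
    (g : Y → W R Z) : W.bind (W.bind u f) g = W.bind u (fun x => W.bind (f x) g) := by
  simp [W.bind, add_assoc]

theorem W.rew_bind {R X Y : Type*} [AddCommMonoid R] (u : W R X) (f : X → W R Y) (γ : Y → R) :
    W.rew (W.bind u f) γ = W.rew u (fun x => W.rew (f x) γ) := by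
  simp [W.bind, W.rew, W.alpha, W.map, add_assoc]

namespace Sel

variable {R : Type*} {X Y Z : Type*} [AddCommMonoid R]

theorem pure_bind (x : X) (f : X → Sel R Y) : bind (pure x) f = f x := by
  funext γ
  simp [bind, pure, W.bind, W.pure]

theorem bind_pure (F : Sel R X) : bind F pure = F := by
  funext γ
  simp [bind, pure, W.bind, W.pure, W.rew, W.alpha, W.map]

theorem bind_assoc (F : Sel R X) (f : X → Sel R Y) (g : Y → Sel R Z) :
    bind (bind F f) g = bind F (fun x => bind (f x) g) := by
  funext γ
  simp only [bind, W.bind_assoc, W.rew_bind]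

/-- Kleisli extension runs its argument at the continuation giving the reward of the rest of the
computation, so by `W.rew_bind` the two sides compare the same two rewards. -/
theorem or_bind [LinearOrder R] (G₀ G₁ : Sel R X) (f : X → Sel R Y) :
    bind (or G₀ G₁) f = or (bind G₀ f) (bind G₁ f) := by
  funext γ
  simp only [bind, or, maxBy, W.rew_bind]
  split_ifs <;> rfl

theorem reward_bind (r : R) (G : Sel R X) (f : X → Sel R Y) :
    bind (reward r G) f = reward r (bind G f) := by
  funext γ
  simp [bind, reward, W.reward, W.bind, add_assoc]

theorem seq_pure : ∀ {n : ℕ} {D : Fin n → Type*} (a : ∀ i, D i),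
    seq (R := R) (fun i => pure (a i)) = pure a
  | 0, _, a => by
    simp only [seq]
    congr 1
    funext i
    exact i.elim0
  | n + 1, D, a => by
    simp only [seq, pure_bind, seq_pure (fun i : Fin n => a i.succ)]
    congr 1
    exact Fin.cons_self_tail a

/-- Pure components to the left of `k` have no effect, so component `k` acts first and all else is
continuation. `K` is chosen before `F`, hence does not depend on what stands at `k`; this is the
frame of a function symbol. -/
theorem seq_eq_bind : ∀ {n : ℕ} {D : Fin n → Type*} (k : Fin n) (a : ∀ i, i < k → D i)
    (G : ∀ i, k < i → Sel R (D i)), ∃ K : D k → Sel R (∀ i, D i), ∀ F : ∀ i, Sel R (D i),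
      (∀ i h, F i = pure (a i h)) → (∀ i h, F i = G i h) → seq F = bind (F k) K
  | 0, _, k, _, _ => k.elim0
  | n + 1, D, k, a, G => by
    induction k using Fin.cases with
    | zero =>
      refine ⟨fun x => bind (seq (fun i : Fin n => G i.succ (Fin.succ_pos i)))
        (fun as => pure (Fin.cons x as)), fun F _ hG => ?_⟩
      simp only [seq, ← hG]
    | succ k =>
      obtain ⟨K, hK⟩ := seq_eq_bind (D := fun i : Fin n => D i.succ) k
        (fun i h => a i.succ (Fin.succ_lt_succ_iff.mpr h))
        (fun i h => G i.succ (Fin.succ_lt_succ_iff.mpr h))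
      refine ⟨fun x => bind (K x) (fun as => pure (Fin.cons (a 0 (Fin.succ_pos k)) as)),
        fun F ha hG => ?_⟩
      simp only [seq, ha 0 (Fin.succ_pos k), pure_bind]
      rw [hK (fun i => F i.succ) (fun i h => ha _ _) (fun i h => hG _ _), bind_assoc]

end Sel

/-! ## Renaming and substitution -/

section Substitution

variable {S : Vocab.{v}}

theorem Tm.rename_rename {Γ : List (Ty S.B)} {σ : Ty S.B} (M : Tm S Γ σ) :
    ∀ {Δ Θ : List (Ty S.B)} (r : ∀ τ, Var Γ τ → Var Δ τ) (q : ∀ τ, Var Δ τ → Var Θ τ),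
      (M.rename r).rename q = M.rename (fun τ x => q τ (r τ x)) := by
  induction M with
  | lam M ih =>
    intro Δ Θ r q
    simp only [Tm.rename, ih]
    congr 2
    funext τ x
    cases x <;> rfl
  | _ => intros; simp only [Tm.rename, *]

theorem Tm.subst_rename {Γ : List (Ty S.B)} {σ : Ty S.B} (M : Tm S Γ σ) :
    ∀ {Δ Θ : List (Ty S.B)} (r : ∀ τ, Var Γ τ → Var Δ τ) (t : ∀ τ, Var Δ τ → Tm S Θ τ),
      (M.rename r).subst t = M.subst (fun τ x => t τ (r τ x)) := by
  induction M with
  | lam M ih =>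
    intro Δ Θ r t
    simp only [Tm.rename, Tm.subst, ih]
    congr 2
    funext τ x
    cases x <;> rfl
  | _ => intros; simp only [Tm.rename, Tm.subst, *]

theorem Tm.rename_subst {Γ : List (Ty S.B)} {σ : Ty S.B} (M : Tm S Γ σ) :
    ∀ {Δ Θ : List (Ty S.B)} (s : ∀ τ, Var Γ τ → Tm S Δ τ) (r : ∀ τ, Var Δ τ → Var Θ τ),
      (M.subst s).rename r = M.subst (fun τ x => (s τ x).rename r) := by
  induction M with
  | lam M ih =>
    intro Δ Θ s r
    simp only [Tm.rename, Tm.subst, ih]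
    congr 2
    funext τ x
    cases x with
    | here => rfl
    | there x => simp only [Tm.liftSubst, Tm.rename_rename]; rfl
  | _ => intros; simp only [Tm.rename, Tm.subst, *]

theorem Tm.subst_subst {Γ : List (Ty S.B)} {σ : Ty S.B} (M : Tm S Γ σ) :
    ∀ {Δ Θ : List (Ty S.B)} (s : ∀ τ, Var Γ τ → Tm S Δ τ) (t : ∀ τ, Var Δ τ → Tm S Θ τ),
      (M.subst s).subst t = M.subst (fun τ x => (s τ x).subst t) := by
  induction M with
  | lam M ih =>
    intro Δ Θ s t
    simp only [Tm.subst, ih]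
    congr 2
    funext τ x
    cases x with
    | here => rfl
    | there x => simp only [Tm.liftSubst, Tm.subst_rename, Tm.rename_subst]
  | _ => intros; simp only [Tm.subst, *]

theorem Tm.subst_var {Γ : List (Ty S.B)} {σ : Ty S.B} (M : Tm S Γ σ) :
    M.subst (fun _ x => .var x) = M := by
  induction M with
  | lam M ih =>
    simp only [Tm.subst]
    congr 1
    conv_rhs => rw [← ih]
    congr 1
    funext τ x
    cases x <;> rfl
  | _ => simp_all [Tm.subst]

/-- Extension of a closing substitution by a closed term. -/
def Tm.consSubst {Γ : List (Ty S.B)} {σ : Ty S.B} (N : Program S σ)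
    (s : ∀ τ, Var Γ τ → Program S τ) : ∀ τ, Var (σ :: Γ) τ → Program S τ
  | _, .here => N
  | _, .there x => s _ x

/-- Serves the abstraction case of the computability argument, where a body under a closing
substitution is instantiated. -/
theorem Tm.inst_subst_lift {Γ : List (Ty S.B)} {σ τ : Ty S.B} (M : Tm S (σ :: Γ) τ)
    (s : ∀ τ, Var Γ τ → Program S τ) (N : Program S σ) :
    (M.subst (Tm.liftSubst s σ)).inst N = M.subst (Tm.consSubst N s) := by
  rw [Tm.inst, Tm.subst_subst]
  congr 1
  funext ρ x
  cases x with
  | here => rfl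
  | there x =>
    simp only [Tm.liftSubst, Tm.subst_rename, Tm.consSubst]
    conv_rhs => rw [← Tm.subst_var (s ρ x)]
    congr 1
    funext _ y
    nomatch y

end Substitution

/-! ## Soundness of the denotational semantics -/

section Soundness

variable {S : Vocab.{v}} {R : Type u} [AddCommMonoid R] [LinearOrder R] (I : Interp S R)

theorem Interp.tm_rename {Γ : List (Ty S.B)} {σ : Ty S.B} (M : Tm S Γ σ) :
    ∀ {Δ : List (Ty S.B)} (r : ∀ τ, Var Γ τ → Var Δ τ) (ρ : I.Env Δ),
      I.tm (M.rename r) ρ = I.tm M (fun τ x => ρ τ (r τ x)) := by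
  induction M with
  | lam M ih =>
    intro Δ r ρ
    simp only [Tm.rename, Interp.tm, ih]
    congr 1
    funext a
    congr 1
    funext τ x
    cases x <;> rfl
  | _ => intros; simp only [Tm.rename, Interp.tm, *]

/-- Variables denote pure computations, so in call-by-value a substitution is semantically sound
only if the substituted terms are pure as well; values are. -/
theorem Interp.tm_subst {Γ : List (Ty S.B)} {σ : Ty S.B} (M : Tm S Γ σ) :
    ∀ {Δ : List (Ty S.B)} (s : ∀ τ, Var Γ τ → Tm S Δ τ) (ρ : I.Env Δ) (θ : I.Env Γ)
      (_ : ∀ τ x, I.tm (s τ x) ρ = Sel.pure (θ τ x)), I.tm (M.subst s) ρ = I.tm M θ := by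
  induction M with
  | lam M ih =>
    intro Δ s ρ θ h
    simp only [Tm.subst, Interp.tm]
    congr 1
    funext a
    refine ih _ _ _ fun τ x => ?_
    cases x with
    | here => rfl
    | there x => exact (I.tm_rename _ _ _).trans (h _ x)
  | var x => intro Δ s ρ θ h; exact h _ x
  | con | star => intros; rfl
  | fn f Ms ih =>
    intro Δ s ρ θ h
    simp only [Tm.subst, Interp.tm, fun i => ih i s ρ θ h]
  | ite L M N ih₁ ih₂ ih₃ =>
    intro Δ s ρ θ h
    simp only [Tm.subst, Interp.tm, ih₁ s ρ θ h, ih₂ s ρ θ h, ih₃ s ρ θ h]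
  | fst M ih | snd M ih =>
    intro Δ s ρ θ h
    simp only [Tm.subst, Interp.tm, ih s ρ θ h]
  | or M N ih₁ ih₂ | reward M N ih₁ ih₂ | pair M N ih₁ ih₂ | app M N ih₁ ih₂ =>
    intro Δ s ρ θ h
    simp only [Tm.subst, Interp.tm, ih₁ s ρ θ h, ih₂ s ρ θ h]

theorem Interp.program_toTm {σ : Ty S.B} (V : Val S σ) :
    I.program V.toTm = Sel.pure (I.val V) := by
  induction V with
  | pair V W ih₁ ih₂ =>
    simp only [Interp.program] at ih₁ ih₂
    simp only [Val.toTm, Interp.program, Interp.tm, ih₁, ih₂, Sel.pure_bind, Interp.val]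
  | _ => rfl

theorem Interp.program_inst {σ τ : Ty S.B} (M : Tm S [σ] τ) (V : Val S σ) :
    I.program (M.inst V.toTm) = I.tm M (I.cons (I.val V) I.nil) := by
  refine I.tm_subst M _ _ _ fun ρ x => ?_
  cases x with
  | here => exact I.program_toTm V
  | there x => nomatch x

/-- Hides the type cast in `ECtx.plug` behind a description of the argument tuple by position. -/
theorem ECtx.plug_fn {ρ : Ty S.B} {n : ℕ} {bs : Fin n → BaseTy S.B} {b : BaseTy S.B}
    (f : S.Fn n bs b) (k : Fin n) (cs : (i : Fin n) → i < k → S.Con (bs i))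
    (E : ECtx S ρ (.base (bs k))) (Ms : (i : Fin n) → k < i → Program S (.base (bs i)))
    (M : Program S ρ) :
    ∃ Ns : (i : Fin n) → Program S (.base (bs i)), (ECtx.fn f k cs E Ms).plug M = .fn f Ns ∧
      (∀ i h, Ns i = .con (cs i h)) ∧ (∀ i h, Ns i = Ms i h) ∧ Ns k = E.plug M := by
  refine ⟨_, rfl, fun i h => ?_, fun i h => ?_, ?_⟩
  · simp [h]
  · simp [h, h.le]
  · simp

theorem Interp.bind_of_frame {ρ σ τ : Ty S.B} {p : Program S ρ → Program S σ}
    {q : Program S ρ → Program S τ}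
    (h : ∃ K : I.ty ρ → Sel R (I.ty σ), ∀ M, I.program (p M) = Sel.bind (I.program M) K)
    (f : I.ty σ → Sel R (I.ty τ)) (hf : ∀ M, I.program (q M) = Sel.bind (I.program (p M)) f) :
    ∃ K : I.ty ρ → Sel R (I.ty τ), ∀ M, I.program (q M) = Sel.bind (I.program M) K := by
  obtain ⟨K, hK⟩ := h
  exact ⟨fun x => Sel.bind (K x) f, fun M => by rw [hf, hK, Sel.bind_assoc]⟩

/-- The hole is what is evaluated first: everything to its left is a value, hence pure. Each frame
adds one Kleisli extension, absorbed into `K` by associativity. -/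
theorem Interp.program_plug {ρ σ : Ty S.B} (E : ECtx S ρ σ) :
    ∃ K : I.ty ρ → Sel R (I.ty σ), ∀ M, I.program (E.plug M) = Sel.bind (I.program M) K := by
  induction E with
  | hole => exact ⟨Sel.pure, fun M => (Sel.bind_pure _).symm⟩
  | @fn n bs b f k cs E Ms ih =>
    obtain ⟨K, hK⟩ := ih
    obtain ⟨L, hL⟩ := Sel.seq_eq_bind (R := R) (D := fun i => I.ty (.base (bs i))) k
      (fun i h => I.con (cs i h)) (fun i h => I.program (Ms i h))
    refine ⟨fun x => Sel.bind (Sel.bind (K x) L)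
      (fun a => Sel.pure (X := I.ty (.base _)) (I.fn f a)), fun M => ?_⟩
    obtain ⟨Ns, hp, h₁, h₂, h₃⟩ := ECtx.plug_fn f k cs E Ms M
    rw [← Sel.bind_assoc, ← Sel.bind_assoc, ← hK, ← h₃,
      ← hL (fun i => I.program (Ns i)) (fun i h => by rw [h₁ i h]; rfl)
        (fun i h => by rw [h₂ i h]), hp]
    rfl
  | ite E N₁ N₂ ih =>
    exact I.bind_of_frame ih (fun b : ULift.{u} Bool =>
      if b.down then I.program N₁ else I.program N₂) fun M => rfl
  | reward E N ih =>
    exact I.bind_of_frame ih (fun r : R => Sel.reward r (I.program N)) fun M => rfl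
  | pairL E N ih =>
    exact I.bind_of_frame ih (fun a => Sel.bind (I.program N) (fun b =>
      Sel.pure (X := I.ty (.prod _ _)) (a, b))) fun M => rfl
  | pairR V E ih =>
    refine I.bind_of_frame ih (fun b => Sel.pure (X := I.ty (.prod _ _)) (I.val V, b)) fun M => ?_
    refine Eq.trans ?_ (Sel.pure_bind (I.val V) (fun a => Sel.bind (I.program (E.plug M)) (fun b =>
      Sel.pure (X := I.ty (.prod _ _)) (a, b))))
    rw [← I.program_toTm V]
    rfl
  | @fst σ τ E ih =>
    exact I.bind_of_frame ih (fun p : I.ty σ × I.ty τ => Sel.pure p.1) fun M => rfl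
  | @snd σ τ E ih =>
    exact I.bind_of_frame ih (fun p : I.ty σ × I.ty τ => Sel.pure p.2) fun M => rfl
  | @appL σ τ E N ih =>
    exact I.bind_of_frame ih (fun f : I.ty σ → Sel R (I.ty τ) => Sel.bind (I.program N) f)
      fun M => rfl
  | @appR σ τ L E ih =>
    exact I.bind_of_frame ih (fun a => I.tm L (I.cons a I.nil)) fun M =>
      Sel.pure_bind (fun a => I.tm L (I.cons a I.nil))
        (fun f : I.ty σ → Sel R (I.ty τ) => Sel.bind (I.program (E.plug M)) f)

theorem Interp.program_red {σ : Ty S.B} {M N : Program S σ} (h : Red M N) :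
    I.program M = I.program N := by
  cases h with
  | fn f cs =>
    simp only [Interp.program, Interp.tm]
    erw [Sel.seq_pure]
    exact (Sel.pure_bind _ _).trans (congrArg Sel.pure (I.fn_val f cs))
  | ite_tt =>
    simp only [Interp.program, Interp.tm, I.con_tt]
    erw [Sel.pure_bind]
    rfl
  | ite_ff =>
    simp only [Interp.program, Interp.tm, I.con_ff]
    erw [Sel.pure_bind]
    rfl
  | fst V W | snd V W =>
    have hV := I.program_toTm V
    have hW := I.program_toTm W
    simp only [Interp.program] at hV hW
    simp only [Interp.program, Interp.tm, hV, hW]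
    erw [Sel.pure_bind, Sel.pure_bind, Sel.pure_bind]
  | beta L V =>
    rw [I.program_inst]
    have hV := I.program_toTm V
    simp only [Interp.program] at hV
    simp only [Interp.program, Interp.tm, hV, Sel.pure_bind]
    exact Sel.pure_bind _ _

theorem Interp.program_step {σ : Ty S.B} {M N : Program S σ} (h : Step M N) :
    I.program M = I.program N := by
  obtain ⟨E, h⟩ := h
  obtain ⟨K, hK⟩ := I.program_plug E
  rw [hK, hK, I.program_red h]

end Soundness

/-! ## Determinism -/

/-- The possible immediate behaviours of a term: no transition, an ordinary transition, or
algebraic operation transitions. -/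
inductive Next (S : Vocab.{v}) (Γ : List (Ty S.B)) (σ : Ty S.B) : Type v
  | done : Next S Γ σ
  | step (M : Tm S Γ σ) : Next S Γ σ
  | or (M₁ M₂ : Tm S Γ σ) : Next S Γ σ
  | reward (c : S.Con .rew) (M : Tm S Γ σ) : Next S Γ σ

section Determinism

variable {S : Vocab.{v}}

def Next.map {Γ : List (Ty S.B)} {σ τ : Ty S.B} (f : Tm S Γ σ → Tm S Γ τ) :
    Next S Γ σ → Next S Γ τ
  | .done => .done
  | .step M => .step (f M)
  | .or M₁ M₂ => .or (f M₁) (f M₂)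
  | .reward c M => .reward c (f M)

/-- The behaviour of a subterm in an evaluation context, or else that of the redex formed by
the values of the subterms. -/
def Next.under {Γ : List (Ty S.B)} {σ τ : Ty S.B} (f : Tm S Γ σ → Tm S Γ τ) (d : Next S Γ τ) :
    Next S Γ σ → Next S Γ τ
  | .done => d
  | x => x.map f

theorem Next.under_of_ne {Γ : List (Ty S.B)} {σ τ : Ty S.B} (f : Tm S Γ σ → Tm S Γ τ)
    (d : Next S Γ τ) {x : Next S Γ σ} (h : x ≠ .done) : Next.under f d x = x.map f := by
  cases x <;> first | exact absurd rfl h | rfl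

theorem Next.under_done {Γ : List (Ty S.B)} {σ τ : Ty S.B} (f : Tm S Γ σ → Tm S Γ τ)
    (d : Next S Γ τ) : Next.under f d .done = d := rfl

theorem Next.map_ne_done {Γ : List (Ty S.B)} {σ τ : Ty S.B} (f : Tm S Γ σ → Tm S Γ τ)
    {x : Next S Γ σ} (h : x ≠ .done) : x.map f ≠ .done := by
  cases x <;> simp_all [Next.map]

theorem Next.map_map {Γ : List (Ty S.B)} {σ τ ρ : Ty S.B} (f : Tm S Γ σ → Tm S Γ τ)
    (g : Tm S Γ τ → Tm S Γ ρ) (x : Next S Γ σ) : (x.map f).map g = x.map (fun M => g (f M)) := by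
  cases x <;> rfl

/-- The substitution of `N` for the last variable. -/
def Tm.singleTail {Γ : List (Ty S.B)} {σ : Ty S.B} (N : Tm S Γ σ) : ∀ τ, Var (σ :: Γ) τ → Tm S Γ τ
  | _, .here => N
  | _, .there x => .var x

open Classical in
/-- The behaviour of `f(M₁, …, Mₙ)`, given that of the arguments. -/
noncomputable def Next.ofFn {Γ : List (Ty S.B)} {n : ℕ} {bs : Fin n → BaseTy S.B} {b : BaseTy S.B}
    (f : S.Fn n bs b) (Ms : (i : Fin n) → Tm S Γ (.base (bs i)))
    (r : (i : Fin n) → Next S Γ (.base (bs i))) : Next S Γ (.base b) :=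
  if h : ∃ k, r k ≠ .done ∧ ∀ i < k, r i = .done then
    (r h.choose).map (fun M => .fn f (Function.update Ms h.choose M))
  else if h : ∃ cs : (i : Fin n) → S.Con (bs i), Ms = fun i => .con (cs i) then
    .step (.con (S.val f h.choose))
  else .done

open Classical in
/-- The immediate behaviour of a term. -/
noncomputable def Tm.next : ∀ {Γ : List (Ty S.B)} {σ : Ty S.B}, Tm S Γ σ → Next S Γ σ
  | _, _, .var _ => .done
  | _, _, .con _ => .done
  | _, _, .fn f Ms => Next.ofFn f Ms (fun i => (Ms i).next)
  | _, _, .ite L M N => Next.under (fun L' => .ite L' M N)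
      (.step (if L = .con S.tt then M else N)) L.next
  | _, _, .or M N => .or M N
  | _, _, .reward N M => Next.under (fun N' => .reward N' M)
      (if h : ∃ c, N = .con c then .reward h.choose M else .done) N.next
  | _, _, .star => .done
  | _, _, .pair M N => Next.under (fun M' => .pair M' N)
      (Next.under (fun N' => .pair M N') .done N.next) M.next
  | _, _, .fst (τ := τ) M => Next.under .fst
      (if h : ∃ p : _ × Tm S _ τ, M = .pair p.1 p.2 then .step h.choose.1 else .done) M.next
  | _, _, .snd (σ := σ) M => Next.under .snd
      (if h : ∃ p : Tm S _ σ × _, M = .pair p.1 p.2 then .step h.choose.2 else .done) M.next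
  | _, _, .lam _ => .done
  | _, _, .app M N => Next.under (fun M' => .app M' N)
      (Next.under (fun N' => .app M N')
        (if h : ∃ L, M = .lam L then .step (h.choose.subst (Tm.singleTail N)) else .done)
        N.next) M.next

theorem Tm.next_toTm {σ : Ty S.B} (V : Val S σ) : V.toTm.next = .done := by
  induction V with
  | pair V W ih₁ ih₂ => simp only [Val.toTm, Tm.next, ih₁, ih₂, Next.under]
  | _ => simp only [Val.toTm, Tm.next]

/-- The leftmost active argument is unique, so the choice in `Next.ofFn` is forced. -/
theorem Next.ofFn_eq_map {Γ : List (Ty S.B)} {n : ℕ} {bs : Fin n → BaseTy S.B} {b : BaseTy S.B}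
    (f : S.Fn n bs b) (Ms : (i : Fin n) → Tm S Γ (.base (bs i)))
    (r : (i : Fin n) → Next S Γ (.base (bs i))) (k : Fin n) (hk : r k ≠ .done)
    (hlt : ∀ i < k, r i = .done) :
    Next.ofFn f Ms r = (r k).map (fun M => .fn f (Function.update Ms k M)) := by
  have h : ∃ k, r k ≠ .done ∧ ∀ i < k, r i = .done := ⟨k, hk, hlt⟩
  have hc : h.choose = k := by
    obtain ⟨h₁, h₂⟩ := h.choose_spec
    rcases lt_trichotomy h.choose k with hl | he | hg
    · exact absurd (hlt _ hl) h₁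
    · exact he
    · exact absurd (h₂ _ hg) hk
  rw [Next.ofFn, dif_pos h, hc]

/-- Whatever lies left of the hole is a value and so inactive; an active hole thus decides the
behaviour of every surrounding frame. -/
theorem Tm.next_plug {ρ σ : Ty S.B} (E : ECtx S ρ σ) (M : Program S ρ) (h : M.next ≠ .done) :
    (E.plug M).next = M.next.map E.plug := by
  induction E with
  | hole => cases hM : M.next <;> simp_all [ECtx.plug, Next.map]
  | fn f k cs E Ms ih =>
    obtain ⟨Ns, hp, h₁, h₂, h₃⟩ := ECtx.plug_fn f k cs E Ms M
    rw [hp, Tm.next, Next.ofFn_eq_map f Ns _ k, h₃, ih, Next.map_map]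
    · congr 1
      funext M'
      obtain ⟨Ns', hp', h₁', h₂', h₃'⟩ := ECtx.plug_fn f k cs E Ms M'
      rw [hp']
      congr 1
      funext i
      rcases lt_trichotomy i k with hi | hi | hi
      · rw [Function.update_of_ne hi.ne, h₁ i hi, h₁' i hi]
      · subst hi; rw [Function.update_self, h₃']
      · rw [Function.update_of_ne hi.ne', h₂ i hi, h₂' i hi]
    · rw [h₃, ih]
      exact Next.map_ne_done _ h
    · intro i hi
      rw [h₁ i hi, Tm.next]
  | pairR V E ih =>
    simp only [ECtx.plug, Tm.next, Tm.next_toTm, Next.under_done, ih]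
    rw [Next.under_of_ne _ _ (Next.map_ne_done _ h), Next.map_map]
  | appR L E ih =>
    simp only [ECtx.plug, Tm.next, ih]
    rw [Next.under_done, Next.under_of_ne _ _ (Next.map_ne_done _ h), Next.map_map]
  | _ =>
    rename_i ih
    simp only [ECtx.plug, Tm.next, ih]
    rw [Next.under_of_ne _ _ (Next.map_ne_done _ h), Next.map_map]

theorem Tm.next_red (htf : S.tt ≠ S.ff) {σ : Ty S.B} {M N : Program S σ} (h : Red M N) :
    M.next = .step N := by
  cases h with
  | fn f cs =>
    have h₁ : ¬ ∃ k : Fin _, (Tm.con (S := S) (Γ := []) (cs k)).next ≠ .done ∧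
        ∀ i < k, (Tm.con (S := S) (Γ := []) (cs i)).next = .done := by
      simp [Tm.next]
    have h₂ : ∃ cs' : (i : Fin _) → S.Con _,
        (fun i => Tm.con (S := S) (Γ := []) (cs i)) = fun i => .con (cs' i) := ⟨cs, rfl⟩
    have h₃ : h₂.choose = cs := by
      funext i
      have := congrFun h₂.choose_spec i
      simp only [Tm.con.injEq] at this
      exact this.symm
    rw [Tm.next, Next.ofFn, dif_neg h₁, dif_pos h₂, h₃]
  | ite_tt => simp [Tm.next, Next.under]
  -- `Tm.next` tests only for `tt`; that `ff` fails the test is where distinctness is needed.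
  | ite_ff => simp [Tm.next, Next.under, htf.symm]
  | fst V W =>
    have h : ∃ p : Program S _ × Program S _, Tm.pair V.toTm W.toTm = .pair p.1 p.2 :=
      ⟨(_, _), rfl⟩
    have hs := Tm.pair.inj h.choose_spec
    simp only [Tm.next, Tm.next_toTm, Next.under]
    rw [dif_pos h, ← hs.1]
  | snd V W =>
    have h : ∃ p : Program S _ × Program S _, Tm.pair V.toTm W.toTm = .pair p.1 p.2 :=
      ⟨(_, _), rfl⟩
    have hs := Tm.pair.inj h.choose_spec
    simp only [Tm.next, Tm.next_toTm, Next.under]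
    rw [dif_pos h, ← hs.2]
  | beta L V =>
    have h : ∃ L', Tm.lam L = .lam L' := ⟨L, rfl⟩
    have hs := Tm.lam.inj h.choose_spec
    simp only [Tm.next, Tm.next_toTm, Next.under]
    rw [dif_pos h, ← hs, Tm.inst]
    congr 2
    funext τ x
    cases x with
    | here => rfl
    | there x => nomatch x

/-- Only this direction is needed. `Tm.next` may report a step where there is none, as for a
conditional on a variable, but a function that all transitions respect suffices for determinism. -/
theorem Tm.next_step (htf : S.tt ≠ S.ff) {σ : Ty S.B} {M N : Program S σ} (h : Step M N) :
    M.next = .step N := by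
  obtain ⟨E, h⟩ := h
  have h' := Tm.next_red htf h
  rw [Tm.next_plug E _ (by simp [h']), h', Next.map]

theorem StepOp.next_or₁ {σ : Ty S.B} {M N : Program S σ} (h : StepOp .or₁ M N) :
    ∃ N', M.next = .or N N' := by
  obtain ⟨E, h⟩ := h
  cases h with
  | or₁ M₁ M₂ =>
    exact ⟨E.plug M₂, by
      rw [Tm.next_plug E _ (by simp [Tm.next])]
      simp [Tm.next, Next.map]⟩

theorem StepOp.next_or₂ {σ : Ty S.B} {M N : Program S σ} (h : StepOp .or₂ M N) :
    ∃ N', M.next = .or N' N := by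
  obtain ⟨E, h⟩ := h
  cases h with
  | or₂ M₁ M₂ =>
    exact ⟨E.plug M₁, by
      rw [Tm.next_plug E _ (by simp [Tm.next])]
      simp [Tm.next, Next.map]⟩

theorem StepOp.next_reward {σ : Ty S.B} {M N : Program S σ} {c : S.Con .rew}
    (h : StepOp (.reward c) M N) : M.next = .reward c N := by
  obtain @⟨_, E, _, _, L, h⟩ := h
  cases h with
  | reward =>
    have h : ∃ c', Tm.con (S := S) (Γ := []) c = .con c' := ⟨c, rfl⟩
    have hs := Tm.con.inj h.choose_spec
    have hn : (Tm.reward (.con c) L).next = .reward c L := by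
      simp only [Tm.next, Next.under]
      rw [dif_pos h, ← hs]
    rw [Tm.next_plug E _ (by simp [hn]), hn, Next.map]

theorem Val.toTm_injective {σ : Ty S.B} (V W : Val S σ) (h : V.toTm = W.toTm) : V = W := by
  induction V with
  | pair V₁ V₂ ih₁ ih₂ =>
    cases W
    simp only [Val.toTm, Tm.pair.injEq] at h
    rw [ih₁ _ h.1, ih₂ _ h.2]
  | _ => cases W; simp_all [Val.toTm]

/-- Evaluation to an effect value, one transition at a time. -/
inductive SmallEvaluates {σ : Ty S.B} : Program S σ → EffVal S σ → Prop
  | val (V : Val S σ) : SmallEvaluates V.toTm (.val V)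
  | step {M M' : Program S σ} {E : EffVal S σ} (h : Step M M') (e : SmallEvaluates M' E) :
      SmallEvaluates M E
  | or {M M₁ M₂ : Program S σ} {E₁ E₂ : EffVal S σ} (h₁ : StepOp .or₁ M M₁)
      (h₂ : StepOp .or₂ M M₂) (e₁ : SmallEvaluates M₁ E₁) (e₂ : SmallEvaluates M₂ E₂) :
      SmallEvaluates M (.or E₁ E₂)
  | reward {M M' : Program S σ} {c : S.Con .rew} {E : EffVal S σ} (h : StepOp (.reward c) M M')
      (e : SmallEvaluates M' E) : SmallEvaluates M (.reward c E)

theorem SmallEvaluates.evaluates {σ : Ty S.B} {M : Program S σ} {E : EffVal S σ}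
    (h : SmallEvaluates M E) : Evaluates M E := by
  induction h with
  | val V => exact .val .refl
  | step h _ ih =>
    cases ih with
    | val h' => exact .val (.head h h')
    | or h₁ h₂ e₁ e₂ =>
      obtain ⟨N₁, p₁, q₁⟩ := h₁
      obtain ⟨N₂, p₂, q₂⟩ := h₂
      exact .or ⟨N₁, .head h p₁, q₁⟩ ⟨N₂, .head h p₂, q₂⟩ e₁ e₂
    | reward h' e =>
      obtain ⟨N, p, q⟩ := h'
      exact .reward ⟨N, .head h p, q⟩ e
  | or h₁ h₂ _ _ ih₁ ih₂ => exact .or ⟨_, .refl, h₁⟩ ⟨_, .refl, h₂⟩ ih₁ ih₂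
  | reward h _ ih => exact .reward ⟨_, .refl, h⟩ ih

theorem SmallEvaluates.of_steps {σ : Ty S.B} {M M' : Program S σ} {E : EffVal S σ}
    (h : Relation.ReflTransGen Step M M') (e : SmallEvaluates M' E) : SmallEvaluates M E := by
  induction h using Relation.ReflTransGen.head_induction_on with
  | refl => exact e
  | head h _ ih => exact .step h ih

/-- Normal forms with respect to the ordinary transitions are unique. -/
theorem Step.normal_unique (htf : S.tt ≠ S.ff) {σ : Ty S.B} {M N₁ N₂ : Program S σ}
    (h₁ : Relation.ReflTransGen Step M N₁) (h₂ : Relation.ReflTransGen Step M N₂)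
    (n₁ : ∀ N, ¬ Step N₁ N) (n₂ : ∀ N, ¬ Step N₂ N) : N₁ = N₂ := by
  induction h₁ using Relation.ReflTransGen.head_induction_on with
  | refl =>
    rcases h₂.cases_head with h | ⟨N, h, _⟩
    · exact h
    · exact absurd h (n₁ N)
  | head h _ ih =>
    rcases h₂.cases_head with rfl | ⟨N, h', h''⟩
    · exact absurd h (n₂ _)
    · have := (Tm.next_step htf h).symm.trans (Tm.next_step htf h')
      simp only [Next.step.injEq] at this
      subst this
      exact ih h''

/-- The two premises of the `or` rule may a priori reach different programs before branching. A
program with an operation transition has no ordinary one, so both are normal forms of the same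
program and coincide. -/
theorem Evaluates.small (htf : S.tt ≠ S.ff) {σ : Ty S.B} {M : Program S σ} {E : EffVal S σ}
    (h : Evaluates M E) : SmallEvaluates M E := by
  induction h with
  | val h => exact .of_steps h (.val _)
  | or h₁ h₂ _ _ ih₁ ih₂ =>
    obtain ⟨N₁, p₁, q₁⟩ := h₁
    obtain ⟨N₂, p₂, q₂⟩ := h₂
    obtain ⟨_, r₁⟩ := q₁.next_or₁
    obtain ⟨_, r₂⟩ := q₂.next_or₂
    have : N₁ = N₂ := Step.normal_unique htf p₁ p₂
      (fun N h => by simp [Tm.next_step htf h] at r₁)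
      (fun N h => by simp [Tm.next_step htf h] at r₂)
    subst this
    exact .of_steps p₁ (.or q₁ q₂ ih₁ ih₂)
  | reward h _ ih =>
    obtain ⟨N, p, q⟩ := h
    exact .of_steps p (.reward q ih)

theorem SmallEvaluates.unique (htf : S.tt ≠ S.ff) {σ : Ty S.B} {M : Program S σ}
    {E E' : EffVal S σ} (h : SmallEvaluates M E) (h' : SmallEvaluates M E') : E = E' := by
  induction h generalizing E' with
  | val V =>
    have hV := Tm.next_toTm V
    generalize hM : V.toTm = M at h' hV
    cases h' with
    | val W => rw [Val.toTm_injective V W hM]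
    | step h => simp [Tm.next_step htf h] at hV
    | or h => obtain ⟨_, h⟩ := h.next_or₁; simp [h] at hV
    | reward h => simp [h.next_reward] at hV
  | step h _ ih =>
    have hM := Tm.next_step htf h
    cases h' with
    | val W => simp [Tm.next_toTm] at hM
    | step h' e =>
      rw [Tm.next_step htf h'] at hM
      cases hM
      exact ih e
    | or h => obtain ⟨_, h⟩ := h.next_or₁; simp [h] at hM
    | reward h => simp [h.next_reward] at hM
  | or h₁ h₂ _ _ ih₁ ih₂ =>
    obtain ⟨_, r₁⟩ := h₁.next_or₁
    obtain ⟨_, r₂⟩ := h₂.next_or₂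
    cases h' with
    | val W => simp [Tm.next_toTm] at r₁
    | step h' e => simp [Tm.next_step htf h'] at r₁
    | or h₁' h₂' e₁ e₂ =>
      obtain ⟨_, r₁'⟩ := h₁'.next_or₁
      obtain ⟨_, r₂'⟩ := h₂'.next_or₂
      rw [r₁'] at r₁
      rw [r₂'] at r₂
      cases r₁
      cases r₂
      rw [ih₁ e₁, ih₂ e₂]
    | reward h => simp [h.next_reward] at r₁
  | reward h _ ih =>
    have hM := h.next_reward
    cases h' with
    | val W => simp [Tm.next_toTm] at hM
    | step h' e => simp [Tm.next_step htf h'] at hM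
    | or h => obtain ⟨_, h⟩ := h.next_or₁; simp [h] at hM
    | reward h' e =>
      rw [h'.next_reward] at hM
      cases hM
      rw [ih e]

end Determinism

/-! ## Termination -/

section Termination

variable {S : Vocab.{v}}

def ECtx.comp {ρ σ : Ty S.B} (E' : ECtx S ρ σ) : ∀ {τ : Ty S.B}, ECtx S σ τ → ECtx S ρ τ
  | _, .hole => E'
  | _, .fn f k cs E Ms => .fn f k cs (E'.comp E) Ms
  | _, .ite E M N => .ite (E'.comp E) M N
  | _, .reward E M => .reward (E'.comp E) M
  | _, .pairL E N => .pairL (E'.comp E) N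
  | _, .pairR V E => .pairR V (E'.comp E)
  | _, .fst E => .fst (E'.comp E)
  | _, .snd E => .snd (E'.comp E)
  | _, .appL E N => .appL (E'.comp E) N
  | _, .appR M E => .appR M (E'.comp E)

theorem ECtx.plug_comp {ρ σ τ : Ty S.B} (E' : ECtx S ρ σ) (E : ECtx S σ τ) (M : Program S ρ) :
    (E'.comp E).plug M = E.plug (E'.plug M) := by
  induction E with
  | hole => rfl
  | _ => rename_i ih; simp only [ECtx.comp, ECtx.plug, ih]

theorem Step.plug {σ τ : Ty S.B} (E : ECtx S σ τ) {M N : Program S σ} (h : Step M N) :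
    Step (E.plug M) (E.plug N) := by
  obtain ⟨E', h⟩ := h
  rw [← ECtx.plug_comp, ← ECtx.plug_comp]
  exact .ctx _ h

theorem StepOp.plug {σ τ : Ty S.B} (E : ECtx S σ τ) {l : OpLabel S} {M N : Program S σ}
    (h : StepOp l M N) : StepOp l (E.plug M) (E.plug N) := by
  obtain ⟨E', h⟩ := h
  rw [← ECtx.plug_comp, ← ECtx.plug_comp]
  exact .ctx _ h

/-- All computation paths of the program terminate, with values satisfying `P`. -/
inductive Terminates {σ : Ty S.B} (P : Val S σ → Prop) : Program S σ → Prop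
  | val {V : Val S σ} (h : P V) : Terminates P V.toTm
  | step {M M' : Program S σ} (h : Step M M') (t : Terminates P M') : Terminates P M
  | or {M M₁ M₂ : Program S σ} (h₁ : StepOp .or₁ M M₁) (h₂ : StepOp .or₂ M M₂)
      (t₁ : Terminates P M₁) (t₂ : Terminates P M₂) : Terminates P M
  | reward {M M' : Program S σ} {c : S.Con .rew} (h : StepOp (.reward c) M M')
      (t : Terminates P M') : Terminates P M

/-- The bind principle for termination: the tree of the hole is grafted with the trees of the
context at its leaves. -/
theorem Terminates.plug {σ τ : Ty S.B} {P : Val S σ → Prop} {Q : Val S τ → Prop}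
    (E : ECtx S σ τ) {M : Program S σ} (h : Terminates P M)
    (hE : ∀ V, P V → Terminates Q (E.plug V.toTm)) : Terminates Q (E.plug M) := by
  induction h with
  | val h => exact hE _ h
  | step h _ ih => exact .step (h.plug E) ih
  | or h₁ h₂ _ _ ih₁ ih₂ => exact .or (h₁.plug E) (h₂.plug E) ih₁ ih₂
  | reward h _ ih => exact .reward (h.plug E) ih

theorem Terminates.red {σ : Ty S.B} {P : Val S σ → Prop} {M M' : Program S σ} (h : Red M M')
    (t : Terminates P M') : Terminates P M :=
  .step (.ctx .hole h) t

theorem Terminates.exists_smallEvaluates {σ : Ty S.B} {P : Val S σ → Prop} {M : Program S σ}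
    (h : Terminates P M) : ∃ E, SmallEvaluates M E := by
  induction h with
  | val _ => exact ⟨_, .val _⟩
  | step h _ ih => exact ih.imp fun _ => .step h
  | or h₁ h₂ _ _ ih₁ ih₂ =>
    obtain ⟨E₁, e₁⟩ := ih₁
    obtain ⟨E₂, e₂⟩ := ih₂
    exact ⟨_, .or h₁ h₂ e₁ e₂⟩
  | reward h _ ih =>
    obtain ⟨E, e⟩ := ih
    exact ⟨_, .reward h e⟩

/-- The computability predicate on values. -/
def Reducible : ∀ σ : Ty S.B, Val S σ → Prop
  | .base _, _ => True
  | .unit, _ => True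
  | .prod σ τ, .pair V W => Reducible σ V ∧ Reducible τ W
  | .arr σ τ, .lam M => ∀ V, Reducible σ V → Terminates (Reducible τ) (M.inst V.toTm)

/-- Induction on the number `m` of trailing arguments not yet known to be constants; at `m = n` the
condition is vacuous, at `m = 0` the term is a redex. -/
theorem Terminates.fn {n : ℕ} {bs : Fin n → BaseTy S.B} {b : BaseTy S.B} (f : S.Fn n bs b) :
    ∀ (m : ℕ) (Ms : (i : Fin n) → Program S (.base (bs i))),
      (∀ i : Fin n, i + m < n → ∃ c, Ms i = .con c) →
      (∀ i, Terminates (Reducible _) (Ms i)) → Terminates (Reducible _) (Tm.fn f Ms)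
  | 0, Ms, hc, _ => by
    choose cs hcs using fun i : Fin n => hc i i.isLt
    obtain rfl : Ms = fun i => .con (cs i) := funext hcs
    exact .red (.fn f cs) (.val (V := .con (S.val f cs)) trivial)
  | m + 1, Ms, hc, ht => by
    by_cases hm : m + 1 ≤ n
    -- The first position not yet known to hold a constant.
    · let k : Fin n := ⟨n - (m + 1), by omega⟩
      have hk : (k : ℕ) + m + 1 = n := by simp only [k]; omega
      have hlt : ∀ i, i < k → ∃ c, Ms i = .con c := fun i hi => hc i (by
        have : (i : ℕ) < k := hi
        omega)
      choose cs hcs using hlt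
      have hplug : ∀ M, (ECtx.fn f k cs .hole (fun i _ => Ms i)).plug M =
          .fn f (Function.update Ms k M) := by
        intro M
        obtain ⟨Ns, hp, h₁, h₂, h₃⟩ := ECtx.plug_fn f k cs .hole (fun i _ => Ms i) M
        rw [hp]
        congr 1
        funext i
        rcases lt_trichotomy i k with hi | hi | hi
        · rw [Function.update_of_ne hi.ne, h₁ i hi, hcs i hi]
        · subst hi; rw [Function.update_self, h₃]; rfl
        · rw [Function.update_of_ne hi.ne', h₂ i hi]
      have hMs := hplug (Ms k)
      rw [Function.update_eq_self] at hMs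
      rw [← hMs]
      refine (ht k).plug _ fun V _ => ?_
      rw [hplug]
      refine Terminates.fn f m _ (fun i hi => ?_) fun i => ?_
      · by_cases hik : i = k
        · subst hik
          rw [Function.update_self]
          cases V with
          | con c => exact ⟨c, rfl⟩
        · rw [Function.update_of_ne hik]
          refine hc i ?_
          have : (i : ℕ) ≠ k := fun h => hik (Fin.ext h)
          omega
      · by_cases hik : i = k
        · subst hik
          rw [Function.update_self]
          exact .val trivial
        · rw [Function.update_of_ne hik]
          exact ht i
    · exact Terminates.fn f m Ms (fun i hi => hc i (by omega)) ht

/-- The fundamental lemma of the computability method. The hypothesis `hb` keeps conditionals from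
getting stuck. -/
theorem Terminates.subst (hb : ∀ c : S.Con .bool, c = S.tt ∨ c = S.ff) {Γ : List (Ty S.B)}
    {σ : Ty S.B} (M : Tm S Γ σ) : ∀ s : ∀ τ, Var Γ τ → Program S τ,
      (∀ τ x, ∃ V, Reducible τ V ∧ s τ x = V.toTm) → Terminates (Reducible σ) (M.subst s) := by
  induction M with
  | var x =>
    intro s hs
    obtain ⟨V, hV, h⟩ := hs _ x
    change Terminates _ (s _ x)
    rw [h]
    exact .val hV
  | con c => exact fun s hs => .val (V := .con c) trivial
  | @fn _ n _ _ f Ms ih =>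
    exact fun s hs => Terminates.fn f n (fun i => (Ms i).subst s)
      (fun i hi => absurd hi (by omega)) fun i => ih i s hs
  | ite L M N ih₁ ih₂ ih₃ =>
    intro s hs
    change Terminates _ ((ECtx.ite .hole (M.subst s) (N.subst s)).plug (L.subst s))
    refine (ih₁ s hs).plug (.ite .hole _ _) fun V _ => ?_
    cases V with
    | con c =>
      rcases hb c with rfl | rfl
      · exact .red (.ite_tt _ _) (ih₂ s hs)
      · exact .red (.ite_ff _ _) (ih₃ s hs)
  | or M N ih₁ ih₂ =>
    exact fun s hs => .or (.ctx .hole (.or₁ _ _)) (.ctx .hole (.or₂ _ _)) (ih₁ s hs) (ih₂ s hs)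
  | reward N M ih₁ ih₂ =>
    intro s hs
    change Terminates _ ((ECtx.reward .hole (M.subst s)).plug (N.subst s))
    refine (ih₁ s hs).plug (.reward .hole _) fun V _ => ?_
    cases V with
    | con c => exact .reward (.ctx .hole (.reward c _)) (ih₂ s hs)
  | star => exact fun s hs => .val (V := .star) trivial
  | pair M N ih₁ ih₂ =>
    intro s hs
    change Terminates _ ((ECtx.pairL .hole (N.subst s)).plug (M.subst s))
    refine (ih₁ s hs).plug (.pairL .hole _) fun V hV => ?_
    change Terminates _ ((ECtx.pairR V .hole).plug (N.subst s))
    refine (ih₂ s hs).plug (.pairR V .hole) fun W hW => ?_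
    exact .val (V := .pair V W) ⟨hV, hW⟩
  | fst M ih =>
    intro s hs
    change Terminates _ ((ECtx.fst .hole).plug (M.subst s))
    refine (ih s hs).plug (.fst .hole) fun V hV => ?_
    cases V with
    | pair V W => exact .red (.fst V W) (.val hV.1)
  | snd M ih =>
    intro s hs
    change Terminates _ ((ECtx.snd .hole).plug (M.subst s))
    refine (ih s hs).plug (.snd .hole) fun V hV => ?_
    cases V with
    | pair V W => exact .red (.snd V W) (.val hV.2)
  | lam M ih =>
    intro s hs
    refine .val (P := Reducible (.arr _ _)) (V := .lam (M.subst (Tm.liftSubst s _)))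
      fun V hV => ?_
    rw [Tm.inst_subst_lift]
    refine ih _ fun τ x => ?_
    cases x with
    | here => exact ⟨V, hV, rfl⟩
    | there x => exact hs _ x
  | app M N ih₁ ih₂ =>
    intro s hs
    change Terminates _ ((ECtx.appL .hole (N.subst s)).plug (M.subst s))
    refine (ih₁ s hs).plug (.appL .hole _) fun V hV => ?_
    cases V with
    | lam L =>
      change Terminates _ ((ECtx.appR L .hole).plug (N.subst s))
      refine (ih₂ s hs).plug (.appR L .hole) fun W hW => ?_
      exact .red (.beta L W) (hV W hW)

theorem exists_smallEvaluates (hb : ∀ c : S.Con .bool, c = S.tt ∨ c = S.ff) {σ : Ty S.B}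
    (M : Program S σ) : ∃ E, SmallEvaluates M E := by
  have h := Terminates.subst hb M (fun _ x => .var x) fun _ x => nomatch x
  rw [Tm.subst_var] at h
  exact h.exists_smallEvaluates

end Termination

/-! ## Selection -/

section Selection

theorem argmax_spec {R T : Type*} [LinearOrder R] [LinearOrder T] [Fintype T] [Nonempty T]
    (γ : T → R) (t : T) : γ t ≤ γ (argmax γ) := by
  have h := Finset.min'_mem _ (exists_maximizer γ)
  exact (Finset.mem_filter.mp h).2 t

theorem argmax_eq {R T : Type*} [LinearOrder R] [LinearOrder T] [Fintype T] [Nonempty T]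
    {γ : T → R} {s : T} (h₁ : ∀ t, γ t ≤ γ s) (h₂ : ∀ t, γ s ≤ γ t → s ≤ t) : argmax γ = s := by
  refine le_antisymm (Finset.min'_le _ _ (by simpa using h₁)) ?_
  exact h₂ _ (argmax_spec γ s)

theorem argmax_le {R T : Type*} [LinearOrder R] [LinearOrder T] [Fintype T] [Nonempty T]
    {γ : T → R} {t : T} (h : γ (argmax γ) ≤ γ t) : argmax γ ≤ t :=
  Finset.min'_le _ _ (by simpa using fun s => (argmax_spec γ s).trans h)

variable {S : Vocab.{v}} {σ : Ty S.B} {R : Type u} [LinearOrder R] [AddCommMonoid R]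
  (I : Interp S R)

/-- The least maximizer on an ordered sum is that of one summand: the left one on ties, since its
strategies come first. -/
theorem Interp.opS_or (E₁ E₂ : EffVal S σ) :
    I.opS (.or E₁ E₂) = maxBy Prod.fst (I.opS E₁) (I.opS E₂) := by
  have key : ∀ s : Str (EffVal.or E₁ E₂), (∀ t, I.strRew (.or E₁ E₂) t ≤ I.strRew (.or E₁ E₂) s) →
      (∀ t, I.strRew (.or E₁ E₂) s ≤ I.strRew (.or E₁ E₂) t → s ≤ t) →
      I.opS (.or E₁ E₂) = I.out (.or E₁ E₂) s := fun s h₁ h₂ => by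
    rw [Interp.opS, argmax_eq h₁ h₂]
  have m₁ := argmax_spec (I.strRew E₁)
  have m₂ := argmax_spec (I.strRew E₂)
  rw [maxBy]
  split_ifs with h
  · have h' : I.strRew E₂ (argmax (I.strRew E₂)) ≤ I.strRew E₁ (argmax (I.strRew E₁)) := h
    refine key (toLex (.inl (argmax (I.strRew E₁)))) ?_ ?_
    · rintro (t | t)
      · exact m₁ t
      · exact (m₂ t).trans h'
    · rintro (t | t) ht
      · exact Sum.Lex.inl_le_inl_iff.mpr (argmax_le ht)
      · exact Sum.Lex.inl_le_inr _ _
  · have h' : I.strRew E₁ (argmax (I.strRew E₁)) < I.strRew E₂ (argmax (I.strRew E₂)) :=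
      not_le.mp h
    refine key (toLex (.inr (argmax (I.strRew E₂)))) ?_ ?_
    · rintro (t | t)
      · exact (m₁ t).trans h'.le
      · exact m₂ t
    · rintro (t | t) ht
      -- The right optimum is strictly better here, so no left strategy can tie with it.
      · exact absurd (ht.trans (m₁ t)) (not_le.mpr h')
      · exact Sum.Lex.inr_le_inr_iff.mpr (argmax_le ht)

/-- Maximizers are unchanged under translation; cancellation is needed to keep new ties from
appearing. -/
theorem Interp.opS_reward [IsOrderedCancelAddMonoid R] (c : S.Con .rew) (E : EffVal S σ) :
    I.opS (.reward c E) = W.reward (I.conRew c) (I.opS E) := by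
  have h : argmax (I.strRew (.reward c E)) = argmax (I.strRew E) := by
    refine argmax_eq (γ := I.strRew (.reward c E)) (s := argmax (I.strRew E)) (fun t => ?_)
      fun t ht => ?_
    · exact add_le_add_right (argmax_spec (I.strRew E) t) _
    · exact argmax_le (le_of_add_le_add_left ht)
  rw [Interp.opS, h]
  rfl

/-- The two transitions could come from different decompositions of `M`; determinism identifies `M₂`
with the right branch in the context of the first. -/
theorem StepOp.program_or {σ : Ty S.B} {M M₁ M₂ : Program S σ} (h₁ : StepOp .or₁ M M₁)
    (h₂ : StepOp .or₂ M M₂) : I.program M = Sel.or (I.program M₁) (I.program M₂) := by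
  obtain @⟨_, E, _, _, N₁, h₁⟩ := h₁
  cases h₁ with
  | or₁ N₁ N₂ =>
    obtain ⟨_, r⟩ := h₂.next_or₂
    have : (E.plug (.or N₁ N₂)).next = .or (E.plug N₁) (E.plug N₂) := by
      rw [Tm.next_plug E _ (by simp [Tm.next])]; simp [Tm.next, Next.map]
    rw [this] at r
    cases r
    obtain ⟨K, hK⟩ := I.program_plug E
    rw [hK, hK, hK, ← Sel.or_bind]
    rfl

theorem StepOp.program_reward {σ : Ty S.B} {M M' : Program S σ} {c : S.Con .rew}
    (h : StepOp (.reward c) M M') : I.program M = Sel.reward (I.conRew c) (I.program M') := by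
  obtain @⟨_, E, _, _, N, h⟩ := h
  cases h with
  | reward =>
    obtain ⟨K, hK⟩ := I.program_plug E
    rw [hK, hK, ← Sel.reward_bind]
    congr 1
    exact Sel.pure_bind (I.conRew c) (fun r : R => Sel.reward r (I.program N))

theorem SmallEvaluates.program_zero [IsOrderedCancelAddMonoid R] {M : Program S σ}
    {E : EffVal S σ} (h : SmallEvaluates M E) :
    I.program M (fun _ => 0) = W.map I.val (I.opS E) := by
  induction h with
  | val V => rw [I.program_toTm]; rfl
  | step h _ ih => rw [I.program_step h, ih]
  | or h₁ h₂ _ _ ih₁ ih₂ =>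
    rw [h₁.program_or I h₂, I.opS_or, Sel.or, ih₁, ih₂]
    simp only [maxBy, W.rew, W.alpha, W.map, add_zero]
    split_ifs <;> rfl
  | reward h _ ih =>
    rw [h.program_reward I, I.opS_reward, Sel.reward, ih]
    rfl

end Selection

end ChoiceReward

/-! ### Selection adequacy -/

theorem mainTheorem1 {S : ChoiceReward.Vocab.{v}} {R : Type u} [AddCommMonoid R]
    [LinearOrder R] [IsOrderedCancelAddMonoid R] (I : ChoiceReward.Interp S R)
    {σ : ChoiceReward.Ty S.B} (M : ChoiceReward.Program S σ) :
    (∃! E : ChoiceReward.EffVal S σ, ChoiceReward.Evaluates M E) ∧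
    ∀ E : ChoiceReward.EffVal S σ, ChoiceReward.Evaluates M E →
      I.program M (fun _ => 0) = ChoiceReward.W.map I.val (I.opS E) := by
  have htf : S.tt ≠ S.ff := fun h => by
    have h' := I.con_tt.symm.trans ((congrArg I.con h).trans I.con_ff)
    exact Bool.noConfusion (ULift.up.inj h')
  -- A Boolean constant denotes one of two truth values, each already denoted by `tt` or `ff`;
  -- injectivity does the rest.
  have hb : ∀ c : S.Con .bool, c = S.tt ∨ c = S.ff := fun c => by
    rcases hc : (I.con c : ULift.{u} Bool) with ⟨_ | _⟩
    · exact .inr (I.con_injective _ (hc.trans I.con_ff.symm))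
    · exact .inl (I.con_injective _ (hc.trans I.con_tt.symm))
  obtain ⟨E, hE⟩ := ChoiceReward.exists_smallEvaluates hb M
  exact ⟨⟨E, hE.evaluates, fun E' h' => (h'.small htf).unique htf hE⟩,
    fun E' h' => (h'.small htf).program_zero I⟩
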